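/- Let $f:(\mathbb R^2,0)\to(\mathbb R^3,0)$ be a Whitney umbrella in normal form, that is, a $C^\infty$ map-germ $$f(u,v)=\Bigl(u,\;uv+\sum_{i=3}^k\frac{b_i}{i!}v^i+O(u,v)^{k+1},\;\sum_{m=2}^k\sum_{i+j=m}\frac{a_{ij}}{i!\,j!}u^iv^j+O(u,v)^{k+1}\Bigr),\qquad k\ge 3,\ a_{02}>0,$$ where $O(u,v)^{k+1}$ stands for a smooth function germ of order at least $k+1$ at the origin. For small $r>0$ consider the curve $\hat\gamma(\theta)=f(r\cos\theta,r\sin\theta)$ for $0<\theta<\pi$, and write $'=d/d\theta$. Let $\mathbf n=\frac{f_u\times f_v}{|f_u\times f_v|}$ be the unit normal of the surface along $\hat\gamma$, let $\hat\gamma'=l\,\mathbf e$ with $l=|\hat\gamma'|$ and $|\mathbf e|=1$, and let $\mathbf b=-\mathbf e\times\mathbf n$. Define $\kappa_1,\kappa_2,\kappa_3$ by $$\mathbf e'=\kappa_1\mathbf b+\kappa_2\mathbf n,\qquad \mathbf b'=-\kappa_1\mathbf e+\kappa_3\mathbf n,\qquad \mathbf n'=-\kappa_2\mathbf e-\kappa_3\mathbf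 b,$$ and put $\hat\kappa_i=l\kappa_i$ $(i=2,3)$ and $$\delta=\kappa_1(\hat\kappa_2^2+\hat\kappa_3^2)-\hat\kappa_2'\hat\kappa_3+\hat\kappa_2\hat\kappa_3'.$$ Here $\delta$ is the function whose non-vanishing says that the normal developable surface $\hat\gamma(\theta)+\beta\,\frac{\kappa_3\mathbf e-\kappa_2\mathbf b}{\sqrt{\kappa_2^2+\kappa_3^2}}$ is non-cylindrical. A function $F$ on $(0,\pi)$, not identically zero, is called a *first term* of a function $x(r,\theta)$ if, for some integer $i\ge0$ and some nowhere vanishing function $x_0$ on $(0,\pi)$, for each $\theta\in(0,\pi)$ one has $x(r,\theta)=F(\theta)x_0(\theta)r^i+O(r^{i+1})$ as $r\to0^+$. (The zero set of a first term depends only on $x$.) **Theorem.** The functions $$F_{\hat\kappa_2}(\theta)=\cos\theta\,\bigl(a_{02}\cos^2\theta+(2a_{02}+a_{20})\sin^2\theta\bigr),$$ $$\begin{aligned}F_\delta(\theta)={}&(1+a_{11}^2)(2a_{02}+a_{20})\cos^4\theta+2a_{02}a_{11}(2a_{02}+a_{20})\cos^3\theta\sin\theta\\&+\bigl(a_{02}^2(2a_{02}+a_{20})-(1+a_{11}^2)(a_{02}+2a_{20})\bigr)\cos^2\theta\sin^2\theta\\&-2a_{02}a_{11}(a_{02}+2a_{20})\cos\theta\sin^3\theta-a_{02}^2(a_{02}+2a_{20})\sin^4\theta\end{aligned}$$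 are first terms of $\hat\kappa_2$ and of $\delta$, respectively. Moreover, where "generically" means "for all $f$ whose coefficients $(a_{20},a_{11},a_{02})$ lie outside the zero set of some fixed nonzero real polynomial", the following hold for these, and for all other, first terms $F_{\hat\kappa_2}$ of $\hat\kappa_2$ and $F_\delta$ of $\delta$. 1. If $2a_{20}+a_{02}<0$, then generically the number of $\theta\in(0,\pi)\setminus\{\pi/2\}$ with $F_{\hat\kappa_2}(\theta)=0$ is $2$ or $0$. 2. If $2a_{02}+a_{20}\ne0$, then generically the number of $\theta\in(0,\pi)$ with $F_\delta(\theta)=0$ is $4$, $2$ or $0$ (it belongs to $\{0,2,4\}$). If $2a_{02}+a_{20}=0$, then $F_\delta(\theta)\neq0$ for every $\theta\in(0,\pi)$. -/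

import Mathlib

open Set Filter Topology Asymptotics
open scoped ContDiff Matrix Nat

noncomputable section

namespace WhitneyUmbrella

/-- A smooth function germ `R` at the origin of `ℝ²` belongs to `O(u,v)^m`: its order at the
origin is at least `m`, i.e. all its derivatives of order less than `m` vanish there. -/
def HasOrderGE (m : ℕ) (R : ℝ × ℝ → ℝ) : Prop :=
  ∀ j < m, iteratedFDeriv ℝ j R 0 = 0

/-- `f` is (a representative of) a Whitney umbrella in normal form, with coefficients `b i`
(`3 ≤ i ≤ k`) and `a i j` (`2 ≤ i + j ≤ k`):
`f(u,v) = (u, uv + B(v) + O(u,v)^(k+1), A_2(u,v) + ... + A_k(u,v) + O(u,v)^(k+1))` where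
`B(v) = ∑ b_i v^i / i!`, `A_m(u,v) = ∑_{i + j = m} a_{ij} u^i v^j / (i! j!)` and `a_{02} > 0`. -/
structure IsNormalForm (f : ℝ × ℝ → Fin 3 → ℝ) (k : ℕ) (b : ℕ → ℝ) (a : ℕ → ℕ → ℝ) : Prop where
  three_le : 3 ≤ k
  a02_pos : 0 < a 0 2
  smooth : ∃ U : Set (ℝ × ℝ), IsOpen U ∧ (0 : ℝ × ℝ) ∈ U ∧ ContDiffOn ℝ ∞ f U ∧
    ∀ p ∈ U, f p 0 = p.1
  second : HasOrderGE (k + 1) fun p : ℝ × ℝ =>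
    f p 1 - (p.1 * p.2 + ∑ i ∈ Finset.Icc 3 k, b i / (i ! : ℝ) * p.2 ^ i)
  third : HasOrderGE (k + 1) fun p : ℝ × ℝ =>
    f p 2 - ∑ m ∈ Finset.Icc 2 k, ∑ i ∈ Finset.range (m + 1),
      a i (m - i) / ((i ! : ℝ) * ((m - i)! : ℝ)) * p.1 ^ i * p.2 ^ (m - i)

/-- The Euclidean length of a vector of `ℝ³` (the norm instance on `Fin 3 → ℝ` is not used). -/
def len (v : Fin 3 → ℝ) : ℝ := √(v ⬝ᵥ v)

/-- The unit normal `f_u × f_v / |f_u × f_v|` of the surface `f`, at a regular point. -/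
def unitNormal (f : ℝ × ℝ → Fin 3 → ℝ) (p : ℝ × ℝ) : Fin 3 → ℝ :=
  (len (fderiv ℝ f p (1, 0) ⨯₃ fderiv ℝ f p (0, 1)))⁻¹ •
    (fderiv ℝ f p (1, 0) ⨯₃ fderiv ℝ f p (0, 1))

/-- The curve `θ ↦ f(r cos θ, r sin θ)` going around the umbrella. -/
def curve (f : ℝ × ℝ → Fin 3 → ℝ) (r θ : ℝ) : Fin 3 → ℝ :=
  f (r * Real.cos θ, r * Real.sin θ)

/-- The function `l` with `(f ∘ γ)' = l e`. -/
def speed (f : ℝ × ℝ → Fin 3 → ℝ) (r θ : ℝ) : ℝ :=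
  len (deriv (curve f r) θ)

/-- The unit tangent `e` of the curve. -/
def tangentVec (f : ℝ × ℝ → Fin 3 → ℝ) (r θ : ℝ) : Fin 3 → ℝ :=
  (speed f r θ)⁻¹ • deriv (curve f r) θ

/-- The unit vector field `n` along the curve: the unit normal of the surface. -/
def normalVec (f : ℝ × ℝ → Fin 3 → ℝ) (r θ : ℝ) : Fin 3 → ℝ :=
  unitNormal f (r * Real.cos θ, r * Real.sin θ)

/-- `b = - e × n`. -/
def binormalVec (f : ℝ × ℝ → Fin 3 → ℝ) (r θ : ℝ) : Fin 3 → ℝ :=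
  -(tangentVec f r θ ⨯₃ normalVec f r θ)

/-! The coefficients of the Frenet-Serre type formula of the orthonormal frame `e, b, n`:
`e' = κ₁ b + κ₂ n`, `b' = - κ₁ e + κ₃ n`, `n' = - κ₂ e - κ₃ b`, with `' = d/dθ`. -/

/-- `κ₁`. -/
def kappa1 (f : ℝ × ℝ → Fin 3 → ℝ) (r θ : ℝ) : ℝ :=
  deriv (tangentVec f r) θ ⬝ᵥ binormalVec f r θ

/-- `κ₂`. -/
def kappa2 (f : ℝ × ℝ → Fin 3 → ℝ) (r θ : ℝ) : ℝ :=
  deriv (tangentVec f r) θ ⬝ᵥ normalVec f r θ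

/-- `κ₃`. -/
def kappa3 (f : ℝ × ℝ → Fin 3 → ℝ) (r θ : ℝ) : ℝ :=
  deriv (binormalVec f r) θ ⬝ᵥ normalVec f r θ

/-- `κ̂₂ = l κ₂`. -/
def kappaHat2 (f : ℝ × ℝ → Fin 3 → ℝ) (r θ : ℝ) : ℝ := speed f r θ * kappa2 f r θ

/-- `κ̂₃ = l κ₃`. -/
def kappaHat3 (f : ℝ × ℝ → Fin 3 → ℝ) (r θ : ℝ) : ℝ := speed f r θ * kappa3 f r θ

/-- The function `δ` of the normal developable surface `f ∘ γ + β D`, where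
`D = (κ₃ e - κ₂ b) / √(κ₂² + κ₃²)`; the surface is non-cylindrical where `δ ≠ 0`. -/
def delta (f : ℝ × ℝ → Fin 3 → ℝ) (r θ : ℝ) : ℝ :=
  kappa1 f r θ * (kappaHat2 f r θ ^ 2 + kappaHat3 f r θ ^ 2)
    - deriv (kappaHat2 f r) θ * kappaHat3 f r θ + kappaHat2 f r θ * deriv (kappaHat3 f r) θ

/-- `F` is a first term of `x(r,θ)`, for `0 < θ < π` and `r → 0+`:
`x(r,θ) = F(θ) x₀(θ) r^i + O(r^(i+1))` for some `i` and some `x₀` that does not vanish anywhere.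
That `F` is not identically zero makes `r^i` the leading power, so that the zeros of a first
term depend on `x` only. -/
def IsFirstTerm (x : ℝ → ℝ → ℝ) (F : ℝ → ℝ) : Prop :=
  ∃ (i : ℕ) (x₀ : ℝ → ℝ), (∀ θ ∈ Ioo 0 Real.pi, x₀ θ ≠ 0) ∧ (∃ θ ∈ Ioo 0 Real.pi, F θ ≠ 0) ∧
    ∀ θ ∈ Ioo 0 Real.pi,
      (fun r : ℝ => x r θ - F θ * x₀ θ * r ^ i) =O[𝓝[>] 0] fun r : ℝ => r ^ (i + 1)

/-- The trigonometric polynomial `F_{κ̂₂}`. -/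
def FKappaHat2 (a20 a02 θ : ℝ) : ℝ :=
  Real.cos θ * (a02 * Real.cos θ ^ 2 + (2 * a02 + a20) * Real.sin θ ^ 2)

/-- The trigonometric polynomial `F_δ`. -/
def FDelta (a20 a11 a02 θ : ℝ) : ℝ :=
  (1 + a11 ^ 2) * (2 * a02 + a20) * Real.cos θ ^ 4
    + 2 * a02 * a11 * (2 * a02 + a20) * Real.cos θ ^ 3 * Real.sin θ
    + (a02 ^ 2 * (2 * a02 + a20) - (1 + a11 ^ 2) * (a02 + 2 * a20))
        * Real.cos θ ^ 2 * Real.sin θ ^ 2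
    - 2 * a02 * a11 * (a02 + 2 * a20) * Real.cos θ * Real.sin θ ^ 3
    - a02 ^ 2 * (a02 + 2 * a20) * Real.sin θ ^ 4

end WhitneyUmbrella

end

/-!
In polar coordinates the umbrella is `f (r cos θ, r sin θ) = (r cos θ, r² G(r, θ), r² H(r, θ))`
with `G` and `H` smooth up to `r = 0`, by Taylor's formula with integral remainder. Hence
`τ = r⁻¹ ∂f/∂θ` and `ν = r⁻¹ f_u × f_v` extend smoothly to `r = 0`, and neither of them vanishes
there for `0 < θ < π`. Since the frame is obtained by normalizing `τ` and `ν`, the functions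
`r⁻¹ κ₁`, `r⁻² κ̂₂`, `r⁻¹ κ̂₃` and `r⁻³ δ` extend smoothly too. Only the quadratic parts of `f`
enter the values at `r = 0`: `r⁻² κ̂₂` becomes `F_κ̂₂ / |ν|` and `r⁻³ δ` becomes
`a₀₂ sin² θ F_δ / |ν|⁵`.

With `ν` taken at `r = 0`,
`F_δ(θ) = |ν|² ((2 a₀₂ + a₂₀) cos² θ - (a₀₂ + 2 a₂₀) sin² θ)`, and `F_κ̂₂` is `cos θ` times a form
of the same shape, so counting zeros amounts to solving `p cos² θ + q sin² θ = 0`.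
-/

namespace WhitneyUmbrella

section HadamardLemma

variable {E F P G : Type*} [NormedAddCommGroup E] [NormedSpace ℝ E] [NormedAddCommGroup F]
  [NormedSpace ℝ F] [NormedAddCommGroup P] [NormedSpace ℝ P] [NormedAddCommGroup G]
  [NormedSpace ℝ G]

open MeasureTheory in
theorem contDiff_setIntegral [FiniteDimensional ℝ G] [MeasurableSpace G] [BorelSpace G]
    {μ : Measure G} [IsLocallyFiniteMeasure μ] {n : ℕ∞} {Φ : P × G → F} (hΦ : ContDiff ℝ n Φ)
    {s : Set G} (hs : Bornology.IsBounded s) (hsm : MeasurableSet s) :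
    ContDiff ℝ n fun p => ∫ t in s, Φ (p, t) ∂μ := by
  -- A cutoff equal to `1` on `s` turns the parametric integral into a convolution at `0`.
  obtain ⟨R, hR, hsR⟩ := hs.subset_ball_lt 0 0
  let χ : ContDiffBump (0 : G) := ⟨R, R + 1, hR, by linarith⟩
  let g : P → G → F := fun p x => χ x • Φ (p, -x)
  have hg : ContDiff ℝ n ↿g := (χ.contDiff.comp contDiff_snd).smul
    (hΦ.comp (contDiff_fst.prodMk contDiff_snd.neg))
  have hconv := contDiffOn_convolution_right_with_param (μ := μ)
    (f := s.indicator fun _ => (1 : ℝ)) (ContinuousLinearMap.lsmul ℝ ℝ) isOpen_univ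
    χ.hasCompactSupport.isCompact
    (fun p x _ hx => by simp only [g, image_eq_zero_of_notMem_tsupport hx, zero_smul])
    ((locallyIntegrable_const 1).indicator hsm) hg.contDiffOn
  rw [univ_prod_univ, contDiffOn_univ] at hconv
  convert hconv.comp (contDiff_id.prodMk contDiff_const : ContDiff ℝ n fun p : P => (p, (0 : G)))
    using 2 with p
  simp only [Function.comp_def, id_eq, convolution_def, ContinuousLinearMap.lsmul_apply]
  rw [← integral_indicator hsm]
  refine integral_congr_ae (.of_forall fun t => ?_)
  by_cases ht : t ∈ s
  · have hχ : χ (-t) = 1 := χ.one_of_mem_closedBall <| by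
      simpa using (mem_ball_zero_iff.1 (hsR ht)).le
    simp only [indicator_of_mem ht, g, zero_sub, neg_neg, hχ, one_smul]
  · simp only [indicator_of_notMem ht, zero_smul]

theorem exists_contDiff_eventuallyEq [FiniteDimensional ℝ E] {n : ℕ∞} {R : E → F} {x : E}
    {U : Set E} (hU : U ∈ 𝓝 x) (hR : ContDiffOn ℝ n R U) :
    ∃ g : E → F, ContDiff ℝ n g ∧ g =ᶠ[𝓝 x] R := by
  obtain ⟨V, hVU, hV, hxV⟩ := mem_nhds_iff.1 hU
  obtain ⟨ε, hε, hball⟩ := Metric.nhds_basis_closedBall.mem_iff.1 (hV.mem_nhds hxV)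
  let χ : ContDiffBump x := ⟨ε / 2, ε, half_pos hε, half_lt_self hε⟩
  refine ⟨fun y => χ y • R y, contMDiff_iff_contDiff.1 <|
    contMDiff_of_tsupport fun y hy => ContDiffAt.contMDiffAt ?_, ?_⟩
  · have hyV : y ∈ V := hball (χ.tsupport_eq ▸ tsupport_smul_subset_left _ _ hy)
    exact χ.contDiffAt.smul (hR.contDiffAt (mem_of_superset (hV.mem_nhds hyV) hVU))
  · filter_upwards [χ.eventuallyEq_one] with y hy
    simp only [hy, Pi.one_apply, one_smul]

/-- The quotient of `R (r • x)` by `r ^ (n + 1)`, written as the integral remainder of Taylor's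
formula so that it makes sense, and is smooth, also at `r = 0`. -/
noncomputable def taylorQuotient (n : ℕ) (R : E → F) (p : ℝ × E) : F :=
  (n ! : ℝ)⁻¹ • ∫ t in 0..1, (1 - t) ^ n • iteratedFDeriv ℝ (n + 1) R (t • p.1 • p.2) fun _ => p.2

theorem contDiff_taylorQuotient {n : ℕ} {R : E → F} (hR : ContDiff ℝ ∞ R) :
    ContDiff ℝ ∞ (taylorQuotient n R) := by
  have hD : ContDiff ℝ ∞ (iteratedFDeriv ℝ (n + 1) R) :=
    hR.iteratedFDeriv_right (by exact_mod_cast le_top)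
  have hΦ : ContDiff ℝ ∞ fun q : (ℝ × E) × ℝ =>
      (1 - q.2) ^ n • iteratedFDeriv ℝ (n + 1) R (q.2 • q.1.1 • q.1.2) fun _ => q.1.2 := by
    have happly := fun z =>
      (ContinuousLinearMap.id ℝ (E [×(n + 1)]→L[ℝ] F)).cpolynomialAt_uncurry_of_multilinear
        (x := z) |>.contDiffAt (n := ∞)
    exact .smul (by fun_prop) ((contDiff_iff_contDiffAt.2 happly).comp
      (.prodMk (hD.comp (by fun_prop)) (contDiff_pi.2 fun _ => by fun_prop)))
  unfold taylorQuotient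
  simp only [intervalIntegral.integral_of_le zero_le_one]
  exact (contDiff_setIntegral hΦ (Metric.isBounded_Ioc 0 1) measurableSet_Ioc).const_smul _

theorem map_smul_eq_pow_smul_taylorQuotient [CompleteSpace F] {n : ℕ} {R : E → F}
    (hR : ContDiff ℝ ∞ R) (h0 : ∀ j ≤ n, iteratedFDeriv ℝ j R 0 = 0) (r : ℝ) (x : E) :
    R (r • x) = r ^ (n + 1) • taylorQuotient n R (r, x) := by
  have h := map_add_eq_sum_add_integral_iteratedFDeriv (f := R) (x := 0) (y := r • x) (n := n)
    fun t _ => hR.contDiffAt.of_le (by exact_mod_cast le_top)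
  rw [zero_add, Finset.sum_eq_zero fun j hj => by
    simp [h0 j (Nat.lt_succ_iff.1 (Finset.mem_range.1 hj))], zero_add] at h
  rw [h, taylorQuotient, smul_comm (r ^ (n + 1)), ← intervalIntegral.integral_smul (r ^ _)]
  congr 1
  refine intervalIntegral.integral_congr fun t _ => ?_
  rw [zero_add, ContinuousMultilinearMap.map_smul_univ, Finset.prod_const, Finset.card_fin,
    smul_comm]

theorem taylorQuotient_zero {n : ℕ} {R : E → F} (h0 : iteratedFDeriv ℝ (n + 1) R 0 = 0) (x : E) :
    taylorQuotient n R (0, x) = 0 := by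
  simp [taylorQuotient, h0]

end HadamardLemma

section FrameAlongCurve

theorem len_sq (v : Fin 3 → ℝ) : len v ^ 2 = v ⬝ᵥ v :=
  Real.sq_sqrt (by simpa using dotProduct_star_self_nonneg v)

theorem len_pos {v : Fin 3 → ℝ} (hv : v ≠ 0) : 0 < len v :=
  Real.sqrt_pos.2 (by simpa using Matrix.dotProduct_self_star_pos_iff.2 hv)

theorem len_smul {r : ℝ} (hr : 0 ≤ r) (v : Fin 3 → ℝ) : len (r • v) = r * len v := by
  rw [len, smul_dotProduct, dotProduct_smul, smul_smul, smul_eq_mul,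
    Real.sqrt_mul (mul_self_nonneg r), Real.sqrt_mul_self hr, len]

/-- The unit vector in the direction of `v`, in the Euclidean length `len`; it is `0` for
`v = 0`. -/
noncomputable def normalized (v : Fin 3 → ℝ) : Fin 3 → ℝ := (len v)⁻¹ • v

theorem normalized_smul {r : ℝ} (hr : 0 < r) (v : Fin 3 → ℝ) :
    normalized (r • v) = normalized v := by
  rw [normalized, normalized, len_smul hr.le, smul_smul, mul_inv_rev, inv_mul_cancel_right₀ hr.ne']

theorem contDiffAt_len {E : Type*} [NormedAddCommGroup E] [NormedSpace ℝ E] {n : ℕ∞}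
    {A : E → Fin 3 → ℝ} {p : E} (hA : ContDiffAt ℝ n A p) (h0 : A p ≠ 0) :
    ContDiffAt ℝ n (fun q => len (A q)) p :=
  (ContDiffAt.sum fun i _ => (contDiffAt_pi.1 hA i).mul (contDiffAt_pi.1 hA i)).sqrt
    (by simpa [dotProduct] using dotProduct_self_eq_zero.not.2 h0)

variable {T N : ℝ → Fin 3 → ℝ} {T' N' : Fin 3 → ℝ} {t : ℝ}

theorem hasDerivAt_cross (hT : HasDerivAt T T' t) (hN : HasDerivAt N N' t) :
    HasDerivAt (fun t => T t ⨯₃ N t) (T t ⨯₃ N' + T' ⨯₃ N t) t :=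
  (crossProduct (R := ℝ)).toContinuousBilinearMap.hasDerivAt_of_bilinear (fun _ => hT) fun _ => hN

theorem hasDerivAt_dotProduct (hT : HasDerivAt T T' t) (hN : HasDerivAt N N' t) :
    HasDerivAt (fun t => T t ⬝ᵥ N t) (T t ⬝ᵥ N' + T' ⬝ᵥ N t) t :=
  (dotProductBilin ℝ ℝ).toContinuousBilinearMap.hasDerivAt_of_bilinear (fun _ => hT) fun _ => hN

theorem exists_hasDerivAt_normalized (hT : HasDerivAt T T' t) (h0 : T t ≠ 0) :
    ∃ α : ℝ, HasDerivAt (fun t => normalized (T t)) ((len (T t))⁻¹ • T' + α • T t) t :=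
  ⟨_, (((hasDerivAt_dotProduct hT hT).sqrt (by simpa using h0)).inv (len_pos h0).ne').smul hT⟩

theorem deriv_normalized_dotProduct_neg_cross (hT : HasDerivAt T T' t) (h0 : T t ≠ 0)
    (v : Fin 3 → ℝ) :
    deriv (fun t => normalized (T t)) t ⬝ᵥ -(normalized (T t) ⨯₃ normalized v) =
      -(T' ⬝ᵥ (T t ⨯₃ v)) / (len (T t) ^ 2 * len v) := by
  obtain ⟨α, hα⟩ := exists_hasDerivAt_normalized hT h0
  rw [hα.deriv]
  simp only [normalized, dotProduct_neg, add_dotProduct, smul_dotProduct, map_smul,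
    LinearMap.smul_apply, dotProduct_smul, dot_self_cross, smul_eq_mul, mul_zero, add_zero, neg_div]
  ring

theorem len_mul_deriv_normalized_dotProduct (hT : HasDerivAt T T' t) (h0 : T t ≠ 0)
    {v : Fin 3 → ℝ} (hv : T t ⬝ᵥ v = 0) :
    len (T t) * (deriv (fun t => normalized (T t)) t ⬝ᵥ normalized v) = T' ⬝ᵥ v / len v := by
  obtain ⟨α, hα⟩ := exists_hasDerivAt_normalized hT h0
  have hlen := (len_pos h0).ne'
  rw [hα.deriv]
  simp only [normalized, add_dotProduct, smul_dotProduct, dotProduct_smul, hv, smul_eq_mul,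
    mul_zero, add_zero]
  field_simp

theorem len_mul_deriv_neg_cross_dotProduct (hT : HasDerivAt T T' t) (hN : HasDerivAt N N' t)
    (hT0 : T t ≠ 0) (hN0 : N t ≠ 0) :
    len (T t) * (deriv (fun t => -(normalized (T t) ⨯₃ normalized (N t))) t ⬝ᵥ normalized (N t)) =
      -((T t ⨯₃ N') ⬝ᵥ N t) / len (N t) ^ 2 := by
  obtain ⟨α, hα⟩ := exists_hasDerivAt_normalized hT hT0
  obtain ⟨β, hβ⟩ := exists_hasDerivAt_normalized hN hN0
  have hlen := (len_pos hT0).ne'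
  have hcross : ∀ u : Fin 3 → ℝ, (u ⨯₃ N t) ⬝ᵥ N t = 0 := fun u => by
    rw [dotProduct_comm, dot_cross_self]
  rw [(hasDerivAt_cross hα hβ).fun_neg.deriv]
  simp only [normalized, neg_dotProduct, add_dotProduct, smul_dotProduct, map_smul, map_add,
    LinearMap.smul_apply, LinearMap.add_apply, dotProduct_smul, hcross, smul_eq_mul, mul_zero,
    add_zero]
  field_simp

end FrameAlongCurve

section PolarBlowup

variable {E : Type*} [NormedAddCommGroup E] [NormedSpace ℝ E]

/-- The partial derivative `∂F/∂r` of a function `F` of `p = (r, θ)`. -/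
noncomputable def radialDeriv (F : ℝ × ℝ → E) (p : ℝ × ℝ) : E := fderiv ℝ F p (1, 0)

/-- The partial derivative `∂F/∂θ` of a function `F` of `p = (r, θ)`. -/
noncomputable def angularDeriv (F : ℝ × ℝ → E) (p : ℝ × ℝ) : E := fderiv ℝ F p (0, 1)

@[fun_prop]
theorem contDiffAt_radialDeriv {F : ℝ × ℝ → E} {p : ℝ × ℝ} (hF : ContDiffAt ℝ ∞ F p) :
    ContDiffAt ℝ ∞ (radialDeriv F) p :=
  (hF.fderiv_right (by simp)).clm_apply contDiffAt_const

@[fun_prop]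
theorem contDiffAt_angularDeriv {F : ℝ × ℝ → E} {p : ℝ × ℝ} (hF : ContDiffAt ℝ ∞ F p) :
    ContDiffAt ℝ ∞ (angularDeriv F) p :=
  (hF.fderiv_right (by simp)).clm_apply contDiffAt_const

theorem hasDerivAt_radialDeriv {F : ℝ × ℝ → E} {r θ : ℝ} (hF : DifferentiableAt ℝ F (r, θ)) :
    HasDerivAt (fun s => F (s, θ)) (radialDeriv F (r, θ)) r :=
  hF.hasFDerivAt.comp_hasDerivAt r ((hasDerivAt_id r).prodMk (hasDerivAt_const r θ))

theorem hasDerivAt_angularDeriv {F : ℝ × ℝ → E} {r θ : ℝ} (hF : DifferentiableAt ℝ F (r, θ)) :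
    HasDerivAt (fun t => F (r, t)) (angularDeriv F (r, θ)) θ :=
  hF.hasFDerivAt.comp_hasDerivAt θ ((hasDerivAt_const θ r).prodMk (hasDerivAt_id θ))

theorem cross_map_rotated_basis (L : ℝ × ℝ →L[ℝ] Fin 3 → ℝ) (θ : ℝ) :
    L (Real.cos θ, Real.sin θ) ⨯₃ L (-Real.sin θ, Real.cos θ) = L (1, 0) ⨯₃ L (0, 1) := by
  have hL : ∀ x y : ℝ, L (x, y) = x • L (1, 0) + y • L (0, 1) := fun x y => by
    rw [← map_smul, ← map_smul, ← map_add]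
    simp
  rw [hL (Real.cos θ), hL (-Real.sin θ)]
  simp only [map_add, map_smul, LinearMap.add_apply, LinearMap.smul_apply, cross_self, smul_zero,
    zero_add, add_zero]
  rw [← cross_anticomm (L (1, 0)), smul_neg, smul_neg, ← smul_neg, ← neg_smul, smul_smul,
    smul_smul, ← add_smul]
  simp [← sq]

/-- Along the circles of radius `r ∈ (0, ε)`, the map `f` is
`(r cos θ, r ^ 2 G(r, θ), r ^ 2 H(r, θ))` with functions `G`, `H` that are smooth also at
`r = 0`. -/
structure IsPolarBlowup (f : ℝ × ℝ → Fin 3 → ℝ) (G H : ℝ × ℝ → ℝ) (ε : ℝ) : Prop where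
  contDiff_fst : ContDiff ℝ ∞ G
  contDiff_snd : ContDiff ℝ ∞ H
  differentiableAt : ∀ r ∈ Ioo 0 ε, ∀ θ, DifferentiableAt ℝ f (r * Real.cos θ, r * Real.sin θ)
  curve_eq : ∀ r ∈ Ioo 0 ε, ∀ θ,
    curve f r θ = ![r * Real.cos θ, r ^ 2 * G (r, θ), r ^ 2 * H (r, θ)]

/-- `r⁻¹ ∂(r ^ 2 G)/∂r`, as a function that is smooth also at `r = 0`. -/
noncomputable def radialPart (G : ℝ × ℝ → ℝ) (p : ℝ × ℝ) : ℝ := 2 * G p + p.1 * radialDeriv G p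

/-- `r⁻³ ∂(r ^ 2 G, r ^ 2 H)/∂(r, θ)`, as a function that is smooth also at `r = 0`. -/
noncomputable def reducedJacobian (G H : ℝ × ℝ → ℝ) (p : ℝ × ℝ) : ℝ :=
  radialPart G p * angularDeriv H p - radialPart H p * angularDeriv G p

/-- The vector field `r⁻¹ ∂f/∂θ` of a polar blow-up. -/
noncomputable def tangentField (G H : ℝ × ℝ → ℝ) (p : ℝ × ℝ) : Fin 3 → ℝ :=
  ![-Real.sin p.2, p.1 * angularDeriv G p, p.1 * angularDeriv H p]

/-- The vector field `r⁻¹ f_u × f_v` of a polar blow-up. -/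
noncomputable def normalField (G H : ℝ × ℝ → ℝ) (p : ℝ × ℝ) : Fin 3 → ℝ :=
  ![p.1 * reducedJacobian G H p,
    -(Real.sin p.2 * radialPart H p + Real.cos p.2 * angularDeriv H p),
    Real.sin p.2 * radialPart G p + Real.cos p.2 * angularDeriv G p]

theorem tangentField_dotProduct_normalField (G H : ℝ × ℝ → ℝ) (p : ℝ × ℝ) :
    tangentField G H p ⬝ᵥ normalField G H p = 0 := by
  simp only [tangentField, normalField, reducedJacobian, dotProduct, Fin.sum_univ_three,
    Matrix.cons_val]
  ring

theorem tangentField_ne_zero {G H : ℝ × ℝ → ℝ} {p : ℝ × ℝ} (hp : Real.sin p.2 ≠ 0) :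
    tangentField G H p ≠ 0 := fun h =>
  neg_ne_zero.2 hp (congrFun h 0)

variable {f : ℝ × ℝ → Fin 3 → ℝ} {G H : ℝ × ℝ → ℝ} {ε r θ : ℝ} {p : ℝ × ℝ}

theorem contDiffAt_tangentField (hG : ContDiffAt ℝ ∞ G p) (hH : ContDiffAt ℝ ∞ H p) :
    ContDiffAt ℝ ∞ (tangentField G H) p := by
  refine contDiffAt_pi.2 fun i => ?_
  fin_cases i <;> simp only [tangentField, Fin.zero_eta, Fin.mk_one, Fin.reduceFinMk,
    Matrix.cons_val] <;> fun_prop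

@[fun_prop]
theorem contDiffAt_radialPart (hG : ContDiffAt ℝ ∞ G p) : ContDiffAt ℝ ∞ (radialPart G) p := by
  unfold radialPart
  fun_prop

@[fun_prop]
theorem contDiffAt_reducedJacobian (hG : ContDiffAt ℝ ∞ G p) (hH : ContDiffAt ℝ ∞ H p) :
    ContDiffAt ℝ ∞ (reducedJacobian G H) p := by
  unfold reducedJacobian
  fun_prop

theorem contDiffAt_normalField (hG : ContDiffAt ℝ ∞ G p) (hH : ContDiffAt ℝ ∞ H p) :
    ContDiffAt ℝ ∞ (normalField G H) p := by
  refine contDiffAt_pi.2 fun i => ?_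
  fin_cases i <;> simp only [normalField, Fin.zero_eta, Fin.mk_one, Fin.reduceFinMk,
    Matrix.cons_val] <;> fun_prop

namespace IsPolarBlowup

theorem hasDerivAt_tangentField (h : IsPolarBlowup f G H ε) (r θ : ℝ) :
    HasDerivAt (fun t => tangentField G H (r, t))
      ![-Real.cos θ, r * angularDeriv (angularDeriv G) (r, θ),
        r * angularDeriv (angularDeriv H) (r, θ)] θ := by
  have hθ : ∀ {F : ℝ × ℝ → ℝ}, ContDiff ℝ ∞ F → HasDerivAt (fun t => r * angularDeriv F (r, t))
      (r * angularDeriv (angularDeriv F) (r, θ)) θ := fun hF =>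
    (hasDerivAt_angularDeriv
      ((contDiffAt_angularDeriv hF.contDiffAt).differentiableAt (by simp))).const_mul r
  refine hasDerivAt_pi.2 fun i => ?_
  fin_cases i
  exacts [(Real.hasDerivAt_sin θ).neg, hθ h.contDiff_fst, hθ h.contDiff_snd]

theorem hasDerivAt_curve (h : IsPolarBlowup f G H ε) (hr : r ∈ Ioo 0 ε) (θ : ℝ) :
    HasDerivAt (curve f r) (r • tangentField G H (r, θ)) θ := by
  have hθ : ∀ {F : ℝ × ℝ → ℝ}, ContDiff ℝ ∞ F →
      HasDerivAt (fun t => r ^ 2 * F (r, t)) (r * (r * angularDeriv F (r, θ))) θ := fun hF => by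
    rw [← mul_assoc, ← sq]
    exact (hasDerivAt_angularDeriv (hF.differentiable (by simp) _)).const_mul _
  rw [funext (h.curve_eq r hr), hasDerivAt_pi]
  intro i
  fin_cases i
  exacts [(Real.hasDerivAt_cos θ).const_mul r, hθ h.contDiff_fst, hθ h.contDiff_snd]

theorem hasDerivAt_curve_radius (h : IsPolarBlowup f G H ε) (hr : r ∈ Ioo 0 ε) (θ : ℝ) :
    HasDerivAt (fun r => curve f r θ)
      ![Real.cos θ, r * radialPart G (r, θ), r * radialPart H (r, θ)] r := by
  have hρ : ∀ {F : ℝ × ℝ → ℝ}, ContDiff ℝ ∞ F →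
      HasDerivAt (fun s => s ^ 2 * F (s, θ)) (r * radialPart F (r, θ)) r := fun {F} hF => by
    refine ((hasDerivAt_pow 2 r).mul
      (hasDerivAt_radialDeriv (hF.differentiable (by simp) (r, θ)))).congr_deriv ?_
    simp only [radialPart]
    ring
  have heq : (fun r => curve f r θ) =ᶠ[𝓝 r]
      fun r => ![r * Real.cos θ, r ^ 2 * G (r, θ), r ^ 2 * H (r, θ)] := by
    filter_upwards [isOpen_Ioo.mem_nhds hr] with s hs using h.curve_eq s hs θ
  refine HasDerivAt.congr_of_eventuallyEq (hasDerivAt_pi.2 fun i => ?_) heq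
  fin_cases i
  exacts [hasDerivAt_mul_const _, hρ h.contDiff_fst, hρ h.contDiff_snd]

theorem cross_partials (h : IsPolarBlowup f G H ε) (hr : r ∈ Ioo 0 ε) (θ : ℝ) :
    fderiv ℝ f (r * Real.cos θ, r * Real.sin θ) (1, 0) ⨯₃
      fderiv ℝ f (r * Real.cos θ, r * Real.sin θ) (0, 1) = r • normalField G H (r, θ) := by
  have hf := (h.differentiableAt r hr θ).hasFDerivAt
  set L := fderiv ℝ f (r * Real.cos θ, r * Real.sin θ)
  have hradial : L (Real.cos θ, Real.sin θ) =
      ![Real.cos θ, r * radialPart G (r, θ), r * radialPart H (r, θ)] :=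
    (hf.comp_hasDerivAt r ((hasDerivAt_mul_const (Real.cos θ)).prodMk
      (hasDerivAt_mul_const (Real.sin θ)))).unique (h.hasDerivAt_curve_radius hr θ)
  have hangular : L (-Real.sin θ, Real.cos θ) = tangentField G H (r, θ) := by
    refine smul_right_injective _ hr.1.ne' ?_
    simp only [← map_smul, Prod.smul_mk, smul_eq_mul]
    exact (hf.comp_hasDerivAt θ (((Real.hasDerivAt_cos θ).const_mul r).prodMk
      ((Real.hasDerivAt_sin θ).const_mul r))).unique (h.hasDerivAt_curve hr θ)
  rw [← cross_map_rotated_basis L θ, hradial, hangular]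
  ext i
  fin_cases i <;>
  · simp only [cross_apply, tangentField, normalField, reducedJacobian, Pi.smul_apply, smul_eq_mul,
      Fin.zero_eta, Fin.mk_one, Fin.reduceFinMk, Matrix.cons_val]
    ring

theorem speed_eq (h : IsPolarBlowup f G H ε) (hr : r ∈ Ioo 0 ε) (θ : ℝ) :
    speed f r θ = r * len (tangentField G H (r, θ)) := by
  rw [speed, (h.hasDerivAt_curve hr θ).deriv, len_smul hr.1.le]

theorem tangentVec_eq (h : IsPolarBlowup f G H ε) (hr : r ∈ Ioo 0 ε) :
    tangentVec f r = fun θ => normalized (tangentField G H (r, θ)) := by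
  ext1 θ
  rw [← normalized_smul hr.1, ← (h.hasDerivAt_curve hr θ).deriv]
  rfl

theorem normalVec_eq (h : IsPolarBlowup f G H ε) (hr : r ∈ Ioo 0 ε) :
    normalVec f r = fun θ => normalized (normalField G H (r, θ)) := by
  ext1 θ
  rw [← normalized_smul hr.1, ← h.cross_partials hr θ]
  rfl

theorem binormalVec_eq (h : IsPolarBlowup f G H ε) (hr : r ∈ Ioo 0 ε) :
    binormalVec f r = fun θ =>
      -(normalized (tangentField G H (r, θ)) ⨯₃ normalized (normalField G H (r, θ))) := by
  ext1 θ
  rw [binormalVec, h.tangentVec_eq hr, h.normalVec_eq hr]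

end IsPolarBlowup

end PolarBlowup

section ReducedInvariants

/-- `r⁻¹ ∂τ/∂θ ⬝ (τ × ν)` for `τ = tangentField G H` and `ν = normalField G H`, as a function that
is smooth also at `r = 0`. -/
noncomputable def geodesicTerm (G H : ℝ × ℝ → ℝ) (p : ℝ × ℝ) : ℝ :=
  -Real.cos p.2 * (angularDeriv G p * normalField G H p 2 - angularDeriv H p * normalField G H p 1)
    + Real.sin p.2 * (angularDeriv (angularDeriv G) p * normalField G H p 2
      - angularDeriv (angularDeriv H) p * normalField G H p 1)
    + p.1 ^ 2 * reducedJacobian G H p * (angularDeriv (angularDeriv G) p * angularDeriv H p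
      - angularDeriv (angularDeriv H) p * angularDeriv G p)

/-- `r⁻¹ κ₁`, as a function that is smooth also at `r = 0`. -/
noncomputable def reducedKappa1 (G H : ℝ × ℝ → ℝ) (p : ℝ × ℝ) : ℝ :=
  -geodesicTerm G H p / (len (tangentField G H p) ^ 2 * len (normalField G H p))

/-- `r⁻² κ̂₂`, as a function that is smooth also at `r = 0`. -/
noncomputable def reducedKappaHat2 (G H : ℝ × ℝ → ℝ) (p : ℝ × ℝ) : ℝ :=
  (-Real.cos p.2 * reducedJacobian G H p + angularDeriv (angularDeriv G) p * normalField G H p 1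
    + angularDeriv (angularDeriv H) p * normalField G H p 2) / len (normalField G H p)

/-- `r⁻¹ κ̂₃`, as a function that is smooth also at `r = 0`. -/
noncomputable def reducedKappaHat3 (G H : ℝ × ℝ → ℝ) (p : ℝ × ℝ) : ℝ :=
  -((tangentField G H p ⨯₃ angularDeriv (normalField G H) p) ⬝ᵥ normalField G H p)
    / len (normalField G H p) ^ 2

/-- `r⁻³ δ`, as a function that is smooth also at `r = 0`. -/
noncomputable def reducedDelta (G H : ℝ × ℝ → ℝ) (p : ℝ × ℝ) : ℝ :=
  reducedKappa1 G H p * (p.1 ^ 2 * reducedKappaHat2 G H p ^ 2 + reducedKappaHat3 G H p ^ 2)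
    - angularDeriv (reducedKappaHat2 G H) p * reducedKappaHat3 G H p
    + reducedKappaHat2 G H p * angularDeriv (reducedKappaHat3 G H) p

variable {f : ℝ × ℝ → Fin 3 → ℝ} {G H : ℝ × ℝ → ℝ} {ε r θ : ℝ} {p : ℝ × ℝ}

theorem contDiffAt_reducedKappa1 (hG : ContDiffAt ℝ ∞ G p) (hH : ContDiffAt ℝ ∞ H p)
    (hs : Real.sin p.2 ≠ 0) (hν : normalField G H p ≠ 0) :
    ContDiffAt ℝ ∞ (reducedKappa1 G H) p := by
  have hν' := contDiffAt_pi.1 (contDiffAt_normalField hG hH)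
  have hτ := contDiffAt_len (contDiffAt_tangentField hG hH) (tangentField_ne_zero hs)
  refine ContDiffAt.div ?_ ((hτ.pow 2).mul (contDiffAt_len (contDiffAt_normalField hG hH) hν))
    (mul_pos (pow_pos (len_pos (tangentField_ne_zero hs)) 2) (len_pos hν)).ne'
  unfold geodesicTerm
  fun_prop

theorem contDiffAt_reducedKappaHat2 (hG : ContDiffAt ℝ ∞ G p) (hH : ContDiffAt ℝ ∞ H p)
    (hν : normalField G H p ≠ 0) : ContDiffAt ℝ ∞ (reducedKappaHat2 G H) p := by
  have hν' := contDiffAt_pi.1 (contDiffAt_normalField hG hH)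
  refine ContDiffAt.div ?_ (contDiffAt_len (contDiffAt_normalField hG hH) hν) (len_pos hν).ne'
  fun_prop

theorem contDiffAt_reducedKappaHat3 (hG : ContDiffAt ℝ ∞ G p) (hH : ContDiffAt ℝ ∞ H p)
    (hν : normalField G H p ≠ 0) : ContDiffAt ℝ ∞ (reducedKappaHat3 G H) p := by
  have hν' := contDiffAt_normalField hG hH
  have hτ := contDiffAt_pi.1 (contDiffAt_tangentField hG hH)
  have := contDiffAt_pi.1 (contDiffAt_angularDeriv hν')
  refine ContDiffAt.div ?_ ((contDiffAt_len hν' hν).pow 2) (pow_pos (len_pos hν) 2).ne'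
  simp only [cross_apply, dotProduct, Fin.sum_univ_three, Matrix.cons_val]
  have hν'' := contDiffAt_pi.1 hν'
  fun_prop

theorem contDiffAt_reducedDelta (hG : ContDiffAt ℝ ∞ G p) (hH : ContDiffAt ℝ ∞ H p)
    (hs : Real.sin p.2 ≠ 0) (hν : normalField G H p ≠ 0) :
    ContDiffAt ℝ ∞ (reducedDelta G H) p := by
  have h₁ := contDiffAt_reducedKappa1 hG hH hs hν
  have h₂ := contDiffAt_reducedKappaHat2 hG hH hν
  have h₃ := contDiffAt_reducedKappaHat3 hG hH hν
  unfold reducedDelta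
  fun_prop

namespace IsPolarBlowup

theorem kappa1_eq (h : IsPolarBlowup f G H ε) (hr : r ∈ Ioo 0 ε) (hs : Real.sin θ ≠ 0) :
    kappa1 f r θ = r * reducedKappa1 G H (r, θ) := by
  rw [kappa1, h.binormalVec_eq hr, h.tangentVec_eq hr, deriv_normalized_dotProduct_neg_cross
    (h.hasDerivAt_tangentField r θ) (tangentField_ne_zero hs), reducedKappa1, ← mul_div_assoc]
  congr 1
  simp only [geodesicTerm, cross_apply, tangentField, normalField, dotProduct, Fin.sum_univ_three,
    Matrix.cons_val]
  ring

theorem kappaHat2_eq (h : IsPolarBlowup f G H ε) (hr : r ∈ Ioo 0 ε) (hs : Real.sin θ ≠ 0) :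
    kappaHat2 f r θ = r ^ 2 * reducedKappaHat2 G H (r, θ) := by
  rw [kappaHat2, kappa2, h.speed_eq hr, h.tangentVec_eq hr, h.normalVec_eq hr, mul_assoc,
    len_mul_deriv_normalized_dotProduct (h.hasDerivAt_tangentField r θ) (tangentField_ne_zero hs)
      (tangentField_dotProduct_normalField G H (r, θ)), reducedKappaHat2, ← mul_div_assoc,
    ← mul_div_assoc]
  congr 1
  simp only [normalField, dotProduct, Fin.sum_univ_three, Matrix.cons_val]
  ring

theorem kappaHat3_eq (h : IsPolarBlowup f G H ε) (hr : r ∈ Ioo 0 ε) (hs : Real.sin θ ≠ 0)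
    (hν : normalField G H (r, θ) ≠ 0) :
    kappaHat3 f r θ = r * reducedKappaHat3 G H (r, θ) := by
  have hN := (contDiffAt_normalField h.contDiff_fst.contDiffAt
    h.contDiff_snd.contDiffAt).differentiableAt (x := (r, θ)) (by simp)
  rw [kappaHat3, kappa3, h.speed_eq hr, h.binormalVec_eq hr, h.normalVec_eq hr, mul_assoc,
    len_mul_deriv_neg_cross_dotProduct (h.hasDerivAt_tangentField r θ)
      (hasDerivAt_angularDeriv hN) (tangentField_ne_zero hs) hν, reducedKappaHat3]

theorem delta_eq (h : IsPolarBlowup f G H ε) (hr : r ∈ Ioo 0 ε) (hs : Real.sin θ ≠ 0)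
    (hν : normalField G H (r, θ) ≠ 0) :
    delta f r θ = r ^ 3 * reducedDelta G H (r, θ) := by
  have hG := h.contDiff_fst.contDiffAt (x := (r, θ))
  have hH := h.contDiff_snd.contDiffAt (x := (r, θ))
  have hs_near : ∀ᶠ t in 𝓝 θ, Real.sin t ≠ 0 := Real.continuous_sin.continuousAt.eventually_ne hs
  have hν_near : ∀ᶠ t in 𝓝 θ, normalField G H (r, t) ≠ 0 :=
    ((contDiffAt_normalField hG hH).continuousAt.comp (f := fun t => (r, t))
      (by fun_prop)).eventually_ne hν
  have h₂ : kappaHat2 f r =ᶠ[𝓝 θ] fun t => r ^ 2 * reducedKappaHat2 G H (r, t) := by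
    filter_upwards [hs_near] with t ht using h.kappaHat2_eq hr ht
  have h₃ : kappaHat3 f r =ᶠ[𝓝 θ] fun t => r * reducedKappaHat3 G H (r, t) := by
    filter_upwards [hs_near, hν_near] with t ht ht' using h.kappaHat3_eq hr ht ht'
  have h₂' := hasDerivAt_angularDeriv
    ((contDiffAt_reducedKappaHat2 hG hH hν).differentiableAt (by simp))
  have h₃' := hasDerivAt_angularDeriv
    ((contDiffAt_reducedKappaHat3 hG hH hν).differentiableAt (by simp))
  rw [delta, h.kappa1_eq hr hs, h₂.deriv_eq, h₃.deriv_eq, h₂.eq_of_nhds, h₃.eq_of_nhds,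
    (h₂'.const_mul _).deriv, (h₃'.const_mul _).deriv, reducedDelta]
  ring

end IsPolarBlowup

end ReducedInvariants

section Limit

/-- `G` and `H` are smooth functions of `(r, θ)` with the values at `r = 0` that the polar blow-up
of a Whitney umbrella has: those of `u v` and of `(a u ^ 2 + 2 b u v + w v ^ 2) / 2` on the unit
circle. -/
structure IsUmbrellaLimit (a b w : ℝ) (G H : ℝ × ℝ → ℝ) : Prop where
  contDiff_fst : ContDiff ℝ ∞ G
  contDiff_snd : ContDiff ℝ ∞ H
  fst_zero : ∀ θ, G (0, θ) = Real.cos θ * Real.sin θ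
  snd_zero : ∀ θ, H (0, θ) =
    (a * Real.cos θ ^ 2 + 2 * b * Real.cos θ * Real.sin θ + w * Real.sin θ ^ 2) / 2

theorem angularDeriv_zero {F : ℝ × ℝ → ℝ} {F₀ : ℝ → ℝ} {F₀' θ : ℝ} (hF : ContDiffAt ℝ ∞ F (0, θ))
    (hF₀ : ∀ t, F (0, t) = F₀ t) (h : HasDerivAt F₀ F₀' θ) : angularDeriv F (0, θ) = F₀' :=
  (hasDerivAt_angularDeriv (hF.differentiableAt (by simp))).unique ((funext hF₀ : _ = F₀) ▸ h)

/-- The squared length of `r⁻¹ f_u × f_v` at `r = 0`, for a Whitney umbrella `f` with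
`a₁₁ = b` and `a₀₂ = w`. -/
noncomputable def limitNormalSq (b w θ : ℝ) : ℝ :=
  (b * Real.cos θ + w * Real.sin θ) ^ 2 + Real.cos θ ^ 2

theorem limitNormalSq_pos (b : ℝ) {w : ℝ} (hw : 0 < w) (θ : ℝ) : 0 < limitNormalSq b w θ := by
  rw [limitNormalSq]
  rcases eq_or_ne (Real.cos θ) 0 with hc | hc
  · have hs : Real.sin θ ≠ 0 := fun hs => by simpa [hs, hc] using Real.sin_sq_add_cos_sq θ
    simp only [hc, mul_zero, zero_add]
    positivity
  · positivity

theorem hasDerivAt_limitNormalSq (b w θ : ℝ) : HasDerivAt (limitNormalSq b w)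
    (2 * (b * Real.cos θ + w * Real.sin θ) * (w * Real.cos θ - b * Real.sin θ)
      - 2 * Real.cos θ * Real.sin θ) θ := by
  have hc := Real.hasDerivAt_cos θ
  refine ((((hc.const_mul b).add ((Real.hasDerivAt_sin θ).const_mul w)).pow 2).add
    (hc.pow 2)).congr_deriv ?_
  simp only [Pi.add_apply]
  ring

theorem hasDerivAt_FKappaHat2 (a w θ : ℝ) : HasDerivAt (FKappaHat2 a w)
    (Real.sin θ * ((w + 2 * a) * Real.cos θ ^ 2 - (2 * w + a) * Real.sin θ ^ 2)) θ := by
  have hc := Real.hasDerivAt_cos θ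
  refine (hc.mul (((hc.pow 2).const_mul w).add
    (((Real.hasDerivAt_sin θ).pow 2).const_mul (2 * w + a)))).congr_deriv ?_
  simp only [Pi.add_apply, Pi.pow_apply]
  ring

theorem FDelta_eq (a b w θ : ℝ) : FDelta a b w θ = limitNormalSq b w θ *
    ((2 * w + a) * Real.cos θ ^ 2 - (w + 2 * a) * Real.sin θ ^ 2) := by
  simp only [FDelta, limitNormalSq]
  ring

namespace IsUmbrellaLimit

variable {a b w : ℝ} {G H : ℝ × ℝ → ℝ}

theorem angularDeriv_fst_zero (h : IsUmbrellaLimit a b w G H) (θ : ℝ) :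
    angularDeriv G (0, θ) = Real.cos θ ^ 2 - Real.sin θ ^ 2 :=
  angularDeriv_zero h.contDiff_fst.contDiffAt h.fst_zero <|
    ((Real.hasDerivAt_cos θ).mul (Real.hasDerivAt_sin θ)).congr_deriv (by ring)

theorem angularDeriv_snd_zero (h : IsUmbrellaLimit a b w G H) (θ : ℝ) :
    angularDeriv H (0, θ) =
      b * (Real.cos θ ^ 2 - Real.sin θ ^ 2) + (w - a) * Real.cos θ * Real.sin θ := by
  have hc := Real.hasDerivAt_cos θ
  have hs := Real.hasDerivAt_sin θ
  refine angularDeriv_zero h.contDiff_snd.contDiffAt h.snd_zero <|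
    (((((hc.pow 2).const_mul a).add ((hc.const_mul (2 * b)).mul hs)).add
      ((hs.pow 2).const_mul w)).div_const 2).congr_deriv ?_
  ring

theorem angularDeriv_angularDeriv_fst_zero (h : IsUmbrellaLimit a b w G H) (θ : ℝ) :
    angularDeriv (angularDeriv G) (0, θ) = -4 * Real.cos θ * Real.sin θ :=
  angularDeriv_zero (contDiffAt_angularDeriv h.contDiff_fst.contDiffAt) h.angularDeriv_fst_zero <|
    (((Real.hasDerivAt_cos θ).pow 2).sub ((Real.hasDerivAt_sin θ).pow 2)).congr_deriv (by ring)

theorem angularDeriv_angularDeriv_snd_zero (h : IsUmbrellaLimit a b w G H) (θ : ℝ) :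
    angularDeriv (angularDeriv H) (0, θ) =
      (w - a) * (Real.cos θ ^ 2 - Real.sin θ ^ 2) - 4 * b * Real.cos θ * Real.sin θ := by
  have hc := Real.hasDerivAt_cos θ
  have hs := Real.hasDerivAt_sin θ
  refine angularDeriv_zero (contDiffAt_angularDeriv h.contDiff_snd.contDiffAt)
    h.angularDeriv_snd_zero <|
    ((((hc.pow 2).sub (hs.pow 2)).const_mul b).add ((hc.const_mul (w - a)).mul hs)).congr_deriv ?_
  ring

theorem normalField_zero (h : IsUmbrellaLimit a b w G H) (θ : ℝ) :
    normalField G H (0, θ) = ![0, -(b * Real.cos θ + w * Real.sin θ), Real.cos θ] := by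
  have hsc := Real.sin_sq_add_cos_sq θ
  simp only [normalField, radialPart, h.fst_zero, h.snd_zero, h.angularDeriv_fst_zero,
    h.angularDeriv_snd_zero, zero_mul, add_zero]
  ext i
  fin_cases i <;> simp only [Fin.zero_eta, Fin.mk_one, Fin.reduceFinMk, Matrix.cons_val]
  · linear_combination (-b * Real.cos θ - w * Real.sin θ) * hsc
  · linear_combination Real.cos θ * hsc

theorem angularDeriv_normalField_zero (h : IsUmbrellaLimit a b w G H) (θ : ℝ) :
    angularDeriv (normalField G H) (0, θ) =
      ![0, b * Real.sin θ - w * Real.cos θ, -Real.sin θ] := by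
  have hν := (contDiffAt_normalField h.contDiff_fst.contDiffAt
    h.contDiff_snd.contDiffAt).differentiableAt (x := (0, θ)) (by simp)
  refine (hasDerivAt_angularDeriv hν).unique ?_
  rw [funext h.normalField_zero, hasDerivAt_pi]
  intro i
  fin_cases i
  · exact hasDerivAt_const θ 0
  · exact ((((Real.hasDerivAt_cos θ).const_mul b).add
      ((Real.hasDerivAt_sin θ).const_mul w)).neg).congr_deriv <| by
        simp only [Fin.mk_one, Matrix.cons_val_one, Matrix.cons_val_zero]
        ring
  · exact Real.hasDerivAt_cos θ

theorem len_normalField_zero (h : IsUmbrellaLimit a b w G H) (θ : ℝ) :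
    len (normalField G H (0, θ)) = √(limitNormalSq b w θ) := by
  rw [len, h.normalField_zero, limitNormalSq]
  congr 1
  simp only [dotProduct, Fin.sum_univ_three, Matrix.cons_val]
  ring

theorem normalField_zero_ne_zero (h : IsUmbrellaLimit a b w G H) (hw : 0 < w) (θ : ℝ) :
    normalField G H (0, θ) ≠ 0 := fun h0 => by
  have := Real.sqrt_pos.2 (limitNormalSq_pos b hw θ)
  rw [← h.len_normalField_zero, h0] at this
  simp [len] at this

theorem eventually_normalField_ne_zero (h : IsUmbrellaLimit a b w G H) (hw : 0 < w) (θ : ℝ) :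
    ∀ᶠ r in 𝓝 0, normalField G H (r, θ) ≠ 0 := by
  have hν : ContinuousAt (normalField G H) (0, θ) :=
    (contDiffAt_normalField h.contDiff_fst.contDiffAt h.contDiff_snd.contDiffAt).continuousAt
  exact (hν.comp (f := fun r => (r, θ)) (by fun_prop)).eventually_ne
    (h.normalField_zero_ne_zero hw θ)

theorem reducedKappa1_zero (h : IsUmbrellaLimit a b w G H) (θ : ℝ) :
    reducedKappa1 G H (0, θ) = -geodesicTerm G H (0, θ) /
      (Real.sin θ ^ 2 * √(limitNormalSq b w θ)) := by
  rw [reducedKappa1, h.len_normalField_zero, len_sq]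
  simp [tangentField, dotProduct, Fin.sum_univ_three, sq]

theorem reducedKappaHat2_zero (h : IsUmbrellaLimit a b w G H) (θ : ℝ) :
    reducedKappaHat2 G H (0, θ) = FKappaHat2 a w θ / √(limitNormalSq b w θ) := by
  rw [reducedKappaHat2, h.len_normalField_zero, FKappaHat2]
  congr 1
  simp only [reducedJacobian, radialPart, h.normalField_zero, h.fst_zero, h.snd_zero,
    h.angularDeriv_fst_zero, h.angularDeriv_snd_zero, h.angularDeriv_angularDeriv_fst_zero,
    h.angularDeriv_angularDeriv_snd_zero, Matrix.cons_val]
  linear_combination (a * Real.cos θ ^ 3 - w * Real.cos θ * Real.sin θ ^ 2) *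
    Real.sin_sq_add_cos_sq θ

theorem reducedKappaHat3_zero (h : IsUmbrellaLimit a b w G H) (θ : ℝ) :
    reducedKappaHat3 G H (0, θ) = -(w * Real.sin θ) / limitNormalSq b w θ := by
  have hn : 0 ≤ limitNormalSq b w θ := by rw [limitNormalSq]; positivity
  rw [reducedKappaHat3, h.len_normalField_zero, Real.sq_sqrt hn, h.normalField_zero,
    h.angularDeriv_normalField_zero]
  congr 1
  simp only [tangentField, cross_apply, dotProduct, Fin.sum_univ_three, Matrix.cons_val]
  linear_combination (-w * Real.sin θ) * Real.sin_sq_add_cos_sq θ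

theorem geodesicTerm_zero (h : IsUmbrellaLimit a b w G H) (θ : ℝ) :
    geodesicTerm G H (0, θ) = -Real.cos θ ^ 2 * (Real.cos θ ^ 2 + 3 * Real.sin θ ^ 2)
      - (b * Real.cos θ * (Real.cos θ ^ 2 + 3 * Real.sin θ ^ 2) + (w - a) * Real.sin θ ^ 3) *
        (b * Real.cos θ + w * Real.sin θ) := by
  simp only [geodesicTerm, h.normalField_zero, h.angularDeriv_fst_zero, h.angularDeriv_snd_zero,
    h.angularDeriv_angularDeriv_fst_zero, h.angularDeriv_angularDeriv_snd_zero, Matrix.cons_val]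
  ring

theorem angularDeriv_reducedKappaHat2_zero (h : IsUmbrellaLimit a b w G H) (hw : 0 < w)
    {θ q' : ℝ} (hq : HasDerivAt (limitNormalSq b w) q' θ) :
    angularDeriv (reducedKappaHat2 G H) (0, θ) =
      (Real.sin θ * ((w + 2 * a) * Real.cos θ ^ 2 - (2 * w + a) * Real.sin θ ^ 2)
          * limitNormalSq b w θ - FKappaHat2 a w θ * q' / 2)
        / (√(limitNormalSq b w θ) * limitNormalSq b w θ) := by
  have hpos := limitNormalSq_pos b hw θ
  have hsqrt := Real.sqrt_pos.2 hpos
  refine angularDeriv_zero (contDiffAt_reducedKappaHat2 h.contDiff_fst.contDiffAt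
    h.contDiff_snd.contDiffAt (h.normalField_zero_ne_zero hw θ)) h.reducedKappaHat2_zero <|
    ((hasDerivAt_FKappaHat2 a w θ).div (hq.sqrt hpos.ne') hsqrt.ne').congr_deriv ?_
  rw [Real.sq_sqrt hpos.le]
  field_simp
  rw [Real.sq_sqrt hpos.le]

theorem angularDeriv_reducedKappaHat3_zero (h : IsUmbrellaLimit a b w G H) (hw : 0 < w)
    {θ q' : ℝ} (hq : HasDerivAt (limitNormalSq b w) q' θ) :
    angularDeriv (reducedKappaHat3 G H) (0, θ) =
      -(w * (Real.cos θ * limitNormalSq b w θ - Real.sin θ * q')) / limitNormalSq b w θ ^ 2 :=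
  angularDeriv_zero (contDiffAt_reducedKappaHat3 h.contDiff_fst.contDiffAt
    h.contDiff_snd.contDiffAt (h.normalField_zero_ne_zero hw θ)) h.reducedKappaHat3_zero <|
    ((((Real.hasDerivAt_sin θ).const_mul w).neg).div hq
      (limitNormalSq_pos b hw θ).ne').congr_deriv (by simp only [Pi.neg_apply]; ring)

theorem reducedDelta_zero (h : IsUmbrellaLimit a b w G H) (hw : 0 < w) {θ : ℝ}
    (hs : Real.sin θ ≠ 0) : reducedDelta G H (0, θ) =
      FDelta a b w θ * (w * Real.sin θ ^ 2 / √(limitNormalSq b w θ) ^ 5) := by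
  have hpos := limitNormalSq_pos b hw θ
  have := Real.sqrt_pos.2 hpos
  have hsq := Real.sq_sqrt hpos.le
  have hq := hasDerivAt_limitNormalSq b w θ
  have hpow : √(limitNormalSq b w θ) ^ 5 = √(limitNormalSq b w θ) * limitNormalSq b w θ ^ 2 := by
    linear_combination √(limitNormalSq b w θ) *
      (√(limitNormalSq b w θ) ^ 2 + limitNormalSq b w θ) * hsq
  have hnum : -geodesicTerm G H (0, θ) * w ^ 2 = FDelta a b w θ * (w * Real.sin θ ^ 2)
      - Real.sin θ * ((w + 2 * a) * Real.cos θ ^ 2 - (2 * w + a) * Real.sin θ ^ 2)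
        * limitNormalSq b w θ * (w * Real.sin θ)
      + FKappaHat2 a w θ * (w * Real.cos θ * limitNormalSq b w θ - w * Real.sin θ / 2
        * (2 * (b * Real.cos θ + w * Real.sin θ) * (w * Real.cos θ - b * Real.sin θ)
          - 2 * Real.cos θ * Real.sin θ)) := by
    rw [FDelta, FKappaHat2, limitNormalSq]
    linear_combination
      (-w ^ 2 * (Real.sin θ ^ 2 + Real.cos θ ^ 2)) * h.geodesicTerm_zero θ
        + geodesicTerm G H (0, θ) * w ^ 2 * Real.sin_sq_add_cos_sq θ
  rw [reducedDelta, h.angularDeriv_reducedKappaHat2_zero hw hq,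
    h.angularDeriv_reducedKappaHat3_zero hw hq, h.reducedKappa1_zero, h.reducedKappaHat2_zero,
    h.reducedKappaHat3_zero, hpow]
  field_simp
  linear_combination (Real.sin θ ^ 2 * √(limitNormalSq b w θ) ^ 2) * hnum

end IsUmbrellaLimit

end Limit

section Existence

theorem eventually_polar {P : ℝ × ℝ → Prop} (hP : ∀ᶠ p in 𝓝 0, P p) :
    ∀ᶠ r : ℝ in 𝓝 0, ∀ θ, P (r * Real.cos θ, r * Real.sin θ) := by
  obtain ⟨ε, hε, hP⟩ := Metric.eventually_nhds_iff.1 hP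
  filter_upwards [Metric.ball_mem_nhds 0 hε] with r hr θ
  have hmul : ∀ {y : ℝ}, |y| ≤ 1 → |r * y| < ε := fun hy => by
    rw [abs_mul]
    exact (mul_le_of_le_one_right (abs_nonneg r) hy).trans_lt (by simpa using hr)
  refine hP ?_
  rw [dist_zero_right, Prod.norm_def, max_lt_iff]
  exact ⟨hmul (Real.abs_cos_le_one θ), hmul (Real.abs_sin_le_one θ)⟩

theorem HasOrderGE.exists_polarQuotient {n : ℕ} {R : ℝ × ℝ → ℝ} {U : Set (ℝ × ℝ)}
    (hR : HasOrderGE (n + 2) R) (hU : U ∈ 𝓝 0) (hRU : ContDiffOn ℝ ∞ R U) :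
    ∃ Q : ℝ × ℝ → ℝ, ContDiff ℝ ∞ Q ∧ (∀ θ, Q (0, θ) = 0) ∧
      ∀ᶠ r in 𝓝 0, ∀ θ, R (r * Real.cos θ, r * Real.sin θ) = r ^ (n + 1) * Q (r, θ) := by
  obtain ⟨g, hg, hgR⟩ := exists_contDiff_eventuallyEq hU hRU
  have hg0 : ∀ j < n + 2, iteratedFDeriv ℝ j g 0 = 0 := fun j hj =>
    (hgR.iteratedFDeriv ℝ j).eq_of_nhds.trans (hR j hj)
  refine ⟨fun p => taylorQuotient n g (p.1, (Real.cos p.2, Real.sin p.2)),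
    (contDiff_taylorQuotient hg).comp (by fun_prop),
    fun θ => taylorQuotient_zero (hg0 _ (by lia)) _, ?_⟩
  filter_upwards [eventually_polar hgR] with r hr θ
  exact (hr θ).symm.trans (map_smul_eq_pow_smul_taylorQuotient (n := n) hg
    (fun j hj => hg0 j (by lia)) r (Real.cos θ, Real.sin θ))

namespace IsNormalForm

variable {f : ℝ × ℝ → Fin 3 → ℝ} {k : ℕ} {b : ℕ → ℝ} {a : ℕ → ℕ → ℝ}

theorem exists_fst_polarBlowup (h : IsNormalForm f k b a) :
    ∃ G : ℝ × ℝ → ℝ, ContDiff ℝ ∞ G ∧ (∀ θ, G (0, θ) = Real.cos θ * Real.sin θ) ∧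
      ∀ᶠ r in 𝓝 0, ∀ θ, f (r * Real.cos θ, r * Real.sin θ) 1 = r ^ 2 * G (r, θ) := by
  obtain ⟨U, hU, h0, hf, -⟩ := h.smooth
  have hsecond : HasOrderGE 3 _ := fun j hj => h.second j (by have := h.three_le; lia)
  obtain ⟨Q, hQ, hQ0, hfQ⟩ := hsecond.exists_polarQuotient (n := 1) (hU.mem_nhds h0)
    ((contDiffOn_pi.1 hf 1).sub (by fun_prop))
  refine ⟨fun p => Real.cos p.2 * Real.sin p.2
    + ∑ i ∈ Finset.Icc 3 k, p.1 ^ (i - 2) * (b i / (i ! : ℝ) * Real.sin p.2 ^ i) + Q p,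
    by fun_prop, fun θ => ?_, ?_⟩
  · simp only [hQ0, add_zero, add_eq_left]
    refine Finset.sum_eq_zero fun i hi => ?_
    rw [zero_pow (by have := Finset.mem_Icc.1 hi; lia), zero_mul]
  · filter_upwards [hfQ] with r hr θ
    have hpow : ∑ i ∈ Finset.Icc 3 k, b i / (i ! : ℝ) * (r * Real.sin θ) ^ i =
        r ^ 2 * ∑ i ∈ Finset.Icc 3 k, r ^ (i - 2) * (b i / (i ! : ℝ) * Real.sin θ ^ i) := by
      rw [Finset.mul_sum]
      refine Finset.sum_congr rfl fun i hi => ?_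
      rw [← mul_assoc, pow_mul_pow_sub _ (by have := Finset.mem_Icc.1 hi; lia)]
      ring
    linear_combination hr θ + hpow

theorem exists_snd_polarBlowup (h : IsNormalForm f k b a) :
    ∃ H : ℝ × ℝ → ℝ, ContDiff ℝ ∞ H ∧ (∀ θ, H (0, θ) = (a 2 0 * Real.cos θ ^ 2
        + 2 * a 1 1 * Real.cos θ * Real.sin θ + a 0 2 * Real.sin θ ^ 2) / 2) ∧
      ∀ᶠ r in 𝓝 0, ∀ θ, f (r * Real.cos θ, r * Real.sin θ) 2 = r ^ 2 * H (r, θ) := by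
  obtain ⟨U, hU, h0, hf, -⟩ := h.smooth
  have hk := h.three_le
  have hthird : HasOrderGE 3 _ := fun j hj => h.third j (by lia)
  obtain ⟨Q, hQ, hQ0, hfQ⟩ := hthird.exists_polarQuotient (n := 1) (hU.mem_nhds h0)
    ((contDiffOn_pi.1 hf 2).sub (by fun_prop))
  refine ⟨fun p => ∑ m ∈ Finset.Icc 2 k, p.1 ^ (m - 2) * ∑ i ∈ Finset.range (m + 1),
    a i (m - i) / ((i ! : ℝ) * ((m - i)! : ℝ)) * Real.cos p.2 ^ i * Real.sin p.2 ^ (m - i) + Q p,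
    by fun_prop, fun θ => ?_, ?_⟩
  · simp only [hQ0, add_zero]
    rw [Finset.sum_eq_single_of_mem 2 (Finset.mem_Icc.2 ⟨le_rfl, by lia⟩)
      fun m hm hm2 => by rw [zero_pow (by have := Finset.mem_Icc.1 hm; lia), zero_mul]]
    simp only [Finset.sum_range_succ, Finset.range_one, Finset.sum_singleton, tsub_self, tsub_zero,
      Nat.reduceAdd, Nat.add_one_sub_one, pow_zero, pow_one, Nat.factorial_zero, Nat.factorial_one,
      Nat.factorial_two, Nat.cast_one, Nat.cast_ofNat, one_mul, mul_one, div_one]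
    ring
  · filter_upwards [hfQ] with r hr θ
    have hpow : ∑ m ∈ Finset.Icc 2 k, ∑ i ∈ Finset.range (m + 1),
          a i (m - i) / ((i ! : ℝ) * ((m - i)! : ℝ)) * (r * Real.cos θ) ^ i
            * (r * Real.sin θ) ^ (m - i) =
        r ^ 2 * ∑ m ∈ Finset.Icc 2 k, r ^ (m - 2) * ∑ i ∈ Finset.range (m + 1),
          a i (m - i) / ((i ! : ℝ) * ((m - i)! : ℝ)) * Real.cos θ ^ i * Real.sin θ ^ (m - i) := by
      rw [Finset.mul_sum]
      refine Finset.sum_congr rfl fun m hm => ?_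
      rw [← mul_assoc, pow_mul_pow_sub _ (Finset.mem_Icc.1 hm).1, Finset.mul_sum]
      refine Finset.sum_congr rfl fun i hi => ?_
      rw [← pow_mul_pow_sub r (Finset.mem_range_succ_iff.1 hi)]
      ring
    linear_combination hr θ + hpow

theorem exists_polarBlowup (h : IsNormalForm f k b a) :
    ∃ (G H : ℝ × ℝ → ℝ) (ε : ℝ), 0 < ε ∧ IsPolarBlowup f G H ε ∧
      IsUmbrellaLimit (a 2 0) (a 1 1) (a 0 2) G H := by
  obtain ⟨U, hU, h0, hf, hf0⟩ := h.smooth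
  obtain ⟨G, hG, hG0, hfG⟩ := h.exists_fst_polarBlowup
  obtain ⟨H, hH, hH0, hfH⟩ := h.exists_snd_polarBlowup
  obtain ⟨ε, hε, hball⟩ := Metric.eventually_nhds_iff.1
    ((eventually_polar (hU.mem_nhds h0)).and (hfG.and hfH))
  replace hball := fun r (hr : r ∈ Ioo 0 ε) =>
    hball (y := r) (by rw [Real.dist_0_eq_abs, abs_of_pos hr.1]; exact hr.2)
  refine ⟨G, H, ε, hε, ⟨hG, hH, fun r hr θ => ?_, fun r hr θ => ?_⟩, ⟨hG, hH, hG0, hH0⟩⟩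
  · exact (hf.contDiffAt (hU.mem_nhds ((hball r hr).1 θ))).differentiableAt (by simp)
  · obtain ⟨hpU, hpG, hpH⟩ := hball r hr
    ext i
    fin_cases i
    exacts [hf0 _ (hpU θ), hpG θ, hpH θ]

end IsNormalForm

end Existence

section FirstTerms

theorem isBigO_pow_of_le {i j : ℕ} (h : i ≤ j) :
    (fun r : ℝ => r ^ j) =O[𝓝 0] fun r => r ^ i := by
  rcases h.eq_or_lt with rfl | h
  exacts [isBigO_refl _ _, (isLittleO_pow_pow h).isBigO]

theorem eq_zero_of_isBigO_pow {c : ℝ} {i : ℕ}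
    (h : (fun r : ℝ => c * r ^ i) =O[𝓝[>] 0] fun r => r ^ (i + 1)) : c = 0 := by
  by_contra hc
  have hpow : (fun r : ℝ => r ^ (i + 1)) =o[𝓝[>] 0] fun r => r ^ i :=
    (isLittleO_pow_pow i.lt_succ_self).mono nhdsWithin_le_nhds
  have hne : ∀ᶠ r : ℝ in 𝓝[>] 0, r ^ i ≠ 0 := by
    filter_upwards [self_mem_nhdsWithin] with r hr using pow_ne_zero i (ne_of_gt hr)
  exact isLittleO_irrefl hne.frequently
    ((isLittleO_const_mul_left_iff hc).1 (h.trans_isLittleO hpow))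

theorem le_of_isBigO_sub_mul_pow {y : ℝ → ℝ} {c d : ℝ} {i j : ℕ} (hc : c ≠ 0)
    (hcy : (fun r => y r - c * r ^ i) =O[𝓝[>] 0] fun r => r ^ (i + 1))
    (hdy : (fun r => y r - d * r ^ j) =O[𝓝[>] 0] fun r => r ^ (j + 1)) : j ≤ i := by
  by_contra! hij
  have hpow {m : ℕ} (hm : i + 1 ≤ m) :
      (fun r : ℝ => r ^ m) =O[𝓝[>] 0] fun r => r ^ (i + 1) :=
    (isBigO_pow_of_le hm).mono nhdsWithin_le_nhds
  have hy : y =O[𝓝[>] 0] fun r => r ^ (i + 1) :=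
    ((hdy.trans (hpow (by lia))).add ((hpow hij).const_mul_left d)).congr_left fun r => by ring
  exact hc (eq_zero_of_isBigO_pow ((hy.sub hcy).congr_left fun r => by ring))

theorem IsFirstTerm.eq_zero_iff {x : ℝ → ℝ → ℝ} {F₁ F₂ : ℝ → ℝ} (h₁ : IsFirstTerm x F₁)
    (h₂ : IsFirstTerm x F₂) {θ : ℝ} (hθ : θ ∈ Ioo 0 Real.pi) : F₁ θ = 0 ↔ F₂ θ = 0 := by
  obtain ⟨i, x₁, hx₁, ⟨t₁, ht₁, hF₁⟩, h₁⟩ := h₁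
  obtain ⟨j, x₂, hx₂, ⟨t₂, ht₂, hF₂⟩, h₂⟩ := h₂
  obtain rfl : i = j := le_antisymm
    (le_of_isBigO_sub_mul_pow (mul_ne_zero hF₂ (hx₂ t₂ ht₂)) (h₂ t₂ ht₂) (h₁ t₂ ht₂))
    (le_of_isBigO_sub_mul_pow (mul_ne_zero hF₁ (hx₁ t₁ ht₁)) (h₁ t₁ ht₁) (h₂ t₁ ht₁))
  have heq : F₁ θ * x₁ θ = F₂ θ * x₂ θ := sub_eq_zero.1 <| eq_zero_of_isBigO_pow (i := i) <|
    ((h₂ θ hθ).sub (h₁ θ hθ)).congr_left fun r => by ring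
  rw [← mul_eq_zero_iff_right (hx₁ θ hθ), heq, mul_eq_zero_iff_right (hx₂ θ hθ)]

theorem isFirstTerm_of_eventually_eq {x : ℝ → ℝ → ℝ} {X : ℝ × ℝ → ℝ} {F x₀ : ℝ → ℝ} {i : ℕ}
    (hx₀ : ∀ θ ∈ Ioo 0 Real.pi, x₀ θ ≠ 0) (hF : ∃ θ ∈ Ioo 0 Real.pi, F θ ≠ 0)
    (hX : ∀ θ ∈ Ioo 0 Real.pi, DifferentiableAt ℝ X (0, θ))
    (hX₀ : ∀ θ ∈ Ioo 0 Real.pi, X (0, θ) = F θ * x₀ θ)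
    (hxX : ∀ θ ∈ Ioo 0 Real.pi, ∀ᶠ r in 𝓝[>] 0, x r θ = r ^ i * X (r, θ)) :
    IsFirstTerm x F := by
  refine ⟨i, x₀, hx₀, hF, fun θ hθ => ?_⟩
  have hslice : DifferentiableAt ℝ (fun r => X (r, θ)) 0 :=
    (hX θ hθ).comp 0 (f := fun r => (r, θ)) (by fun_prop)
  have hO : (fun r => X (r, θ) - F θ * x₀ θ) =O[𝓝[>] 0] fun r => r := by
    simpa only [hX₀ θ hθ, sub_zero] using hslice.isBigO_sub.mono nhdsWithin_le_nhds
  refine ((isBigO_refl (fun r : ℝ => r ^ i) _).mul hO).congr' ?_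
    (.of_forall fun r => (pow_succ r i).symm)
  filter_upwards [hxX θ hθ] with r hr
  rw [hr]
  ring

theorem sin_pos_of_mem {θ : ℝ} (hθ : θ ∈ Ioo 0 Real.pi) : 0 < Real.sin θ :=
  Real.sin_pos_of_pos_of_lt_pi hθ.1 hθ.2

theorem exists_mul_cos_sq_add_mul_sin_sq_ne_zero {p q : ℝ} (h : p ≠ 0 ∨ q ≠ 0) :
    ∃ θ ∈ Ioo 0 Real.pi, Real.cos θ ≠ 0 ∧ p * Real.cos θ ^ 2 + q * Real.sin θ ^ 2 ≠ 0 := by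
  by_contra! H
  have hpi := Real.pi_pos
  have h3 := H (Real.pi / 3) ⟨by linarith, by linarith⟩ (by rw [Real.cos_pi_div_three]; norm_num)
  have h6 := H (Real.pi / 6) ⟨by linarith, by linarith⟩ (by rw [Real.cos_pi_div_six]; positivity)
  rw [Real.sin_sq, Real.cos_pi_div_three] at h3
  rw [Real.sin_pi_div_six, Real.cos_sq', Real.sin_pi_div_six] at h6
  rcases h with h | h <;> exact h (by linarith)

namespace IsNormalForm

variable {f : ℝ × ℝ → Fin 3 → ℝ} {k : ℕ} {b : ℕ → ℝ} {a : ℕ → ℕ → ℝ}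

theorem isFirstTerm_kappaHat2 (h : IsNormalForm f k b a) :
    IsFirstTerm (kappaHat2 f) (FKappaHat2 (a 2 0) (a 0 2)) := by
  obtain ⟨G, H, ε, hε, hblow, hlim⟩ := h.exists_polarBlowup
  have hw := h.a02_pos
  refine isFirstTerm_of_eventually_eq (i := 2) (X := reducedKappaHat2 G H)
    (x₀ := fun θ => (√(limitNormalSq (a 1 1) (a 0 2) θ))⁻¹)
    (fun θ _ => inv_ne_zero (Real.sqrt_pos.2 (limitNormalSq_pos _ hw θ)).ne') ?_
    (fun θ _ => (contDiffAt_reducedKappaHat2 hlim.contDiff_fst.contDiffAt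
      hlim.contDiff_snd.contDiffAt (hlim.normalField_zero_ne_zero hw θ)).differentiableAt (by simp))
    (fun θ _ => by rw [hlim.reducedKappaHat2_zero, div_eq_mul_inv]) fun θ hθ => ?_
  · obtain ⟨θ, hθ, hc, hne⟩ := exists_mul_cos_sq_add_mul_sin_sq_ne_zero
      (q := 2 * a 0 2 + a 2 0) (.inl hw.ne')
    exact ⟨θ, hθ, mul_ne_zero hc hne⟩
  · filter_upwards [Ioo_mem_nhdsGT hε] with r hr
    exact hblow.kappaHat2_eq hr (sin_pos_of_mem hθ).ne'

theorem isFirstTerm_delta (h : IsNormalForm f k b a) :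
    IsFirstTerm (delta f) (FDelta (a 2 0) (a 1 1) (a 0 2)) := by
  obtain ⟨G, H, ε, hε, hblow, hlim⟩ := h.exists_polarBlowup
  have hw := h.a02_pos
  refine isFirstTerm_of_eventually_eq (i := 3) (X := reducedDelta G H)
    (x₀ := fun θ => a 0 2 * Real.sin θ ^ 2 / √(limitNormalSq (a 1 1) (a 0 2) θ) ^ 5)
    (fun θ hθ => ?_) ?_ (fun θ hθ => ?_)
    (fun θ hθ => hlim.reducedDelta_zero hw (sin_pos_of_mem hθ).ne') fun θ hθ => ?_
  · exact (div_pos (mul_pos hw (pow_pos (sin_pos_of_mem hθ) 2))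
      (pow_pos (Real.sqrt_pos.2 (limitNormalSq_pos _ hw θ)) 5)).ne'
  · obtain ⟨θ, hθ, -, hne⟩ := exists_mul_cos_sq_add_mul_sin_sq_ne_zero (p := 2 * a 0 2 + a 2 0)
      (q := -(a 0 2 + 2 * a 2 0)) (by by_contra! H; linarith [H.1, H.2])
    refine ⟨θ, hθ, ?_⟩
    rw [FDelta_eq]
    exact mul_ne_zero (limitNormalSq_pos _ hw θ).ne' (by rwa [neg_mul, ← sub_eq_add_neg] at hne)
  · have hdiff : ContDiffAt ℝ ∞ (reducedDelta G H) (0, θ) :=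
      contDiffAt_reducedDelta hlim.contDiff_fst.contDiffAt hlim.contDiff_snd.contDiffAt
        (sin_pos_of_mem hθ).ne' (hlim.normalField_zero_ne_zero hw θ)
    exact hdiff.differentiableAt (by simp)
  · filter_upwards [Ioo_mem_nhdsGT hε,
      nhdsWithin_le_nhds (hlim.eventually_normalField_ne_zero hw θ)] with r hr hν
    exact hblow.delta_eq hr (sin_pos_of_mem hθ).ne' hν

end IsNormalForm

end FirstTerms

section Counting

theorem cos_eq_zero_iff_of_mem {θ : ℝ} (hθ : θ ∈ Ioo 0 Real.pi) :
    Real.cos θ = 0 ↔ θ = Real.pi / 2 := by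
  rw [← Real.cos_pi_div_two]
  exact Real.injOn_cos.eq_iff (Ioo_subset_Icc_self hθ)
    ⟨by positivity, half_le_self Real.pi_pos.le⟩

theorem setOf_cos_sq_eq {t : ℝ} (h0 : 0 < t) (h1 : t < 1) :
    {θ : ℝ | θ ∈ Ioo 0 Real.pi ∧ Real.cos θ ^ 2 = t} = {Real.arccos √t, Real.arccos (-√t)} := by
  have hs0 : 0 < √t := Real.sqrt_pos.2 h0
  have hs1 : √t < 1 := by rwa [Real.sqrt_lt' one_pos, one_pow]
  have arccos_mem {y : ℝ} (hy : y ∈ Ioo (-1) 1) : Real.arccos y ∈ Ioo 0 Real.pi :=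
    ⟨Real.arccos_pos.2 hy.2, (Real.arccos_le_pi y).lt_of_ne fun he =>
      hy.1.not_ge (Real.arccos_eq_pi.1 he)⟩
  ext θ
  simp only [mem_ofPred_eq, mem_insert_iff, mem_singleton_iff]
  constructor
  · rintro ⟨hθ, he⟩
    rw [← Real.sq_sqrt h0.le, sq_eq_sq_iff_eq_or_eq_neg] at he
    exact he.imp (fun h => by rw [← h, Real.arccos_cos hθ.1.le hθ.2.le])
      (fun h => by rw [← h, Real.arccos_cos hθ.1.le hθ.2.le])
  · rintro (rfl | rfl)
    · exact ⟨arccos_mem ⟨by linarith, hs1⟩, by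
        rw [Real.cos_arccos (by linarith) hs1.le, Real.sq_sqrt h0.le]⟩
    · exact ⟨arccos_mem ⟨by linarith, by linarith⟩, by
        rw [Real.cos_arccos (by linarith) (by linarith), neg_sq, Real.sq_sqrt h0.le]⟩

theorem encard_setOf_cos_sq_eq {t : ℝ} (h0 : 0 < t) (h1 : t < 1) :
    {θ : ℝ | θ ∈ Ioo 0 Real.pi ∧ Real.cos θ ^ 2 = t}.encard = 2 := by
  have hs0 : 0 < √t := Real.sqrt_pos.2 h0
  have hs1 : √t < 1 := by rwa [Real.sqrt_lt' one_pos, one_pow]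
  rw [setOf_cos_sq_eq h0 h1, encard_pair]
  exact fun he => by
    linarith [Real.arccos_injOn ⟨by linarith, hs1.le⟩ ⟨by linarith, by linarith⟩ he]

theorem encard_setOf_mul_cos_sq_add_mul_sin_sq_eq_zero_of_neg {p q : ℝ} (h : p * q < 0) :
    {θ : ℝ | θ ∈ Ioo 0 Real.pi ∧ p * Real.cos θ ^ 2 + q * Real.sin θ ^ 2 = 0}.encard = 2 := by
  have hqp : q - p ≠ 0 := fun h0 => by nlinarith [sq_nonneg (p + q), sub_eq_zero.1 h0]
  have hpos : 0 < (q - p) ^ 2 := by positivity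
  have hzero (θ : ℝ) : p * Real.cos θ ^ 2 + q * Real.sin θ ^ 2 = 0 ↔
      Real.cos θ ^ 2 = q / (q - p) := by
    rw [Real.sin_sq, eq_div_iff hqp]
    constructor <;> intro h <;> linarith
  simp only [hzero]
  refine encard_setOf_cos_sq_eq ?_ ?_
  · rw [show q / (q - p) = (q ^ 2 - p * q) / (q - p) ^ 2 by field_simp]
    exact div_pos (by linarith [sq_nonneg q]) hpos
  · rw [← sub_pos, show 1 - q / (q - p) = (p ^ 2 - p * q) / (q - p) ^ 2 by field_simp; ring]
    exact div_pos (by linarith [sq_nonneg p]) hpos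

theorem mul_cos_sq_add_mul_sin_sq_ne_zero {p q θ : ℝ} (hq : q ≠ 0) (h : 0 ≤ p * q)
    (hθ : Real.sin θ ≠ 0) :
    p * Real.cos θ ^ 2 + q * Real.sin θ ^ 2 ≠ 0 := fun h0 => by
  have hsum : p * q * Real.cos θ ^ 2 + q ^ 2 * Real.sin θ ^ 2 = 0 := by
    linear_combination q * h0
  have : 0 < q ^ 2 * Real.sin θ ^ 2 := by positivity
  have : 0 ≤ p * q * Real.cos θ ^ 2 := by positivity
  linarith

theorem encard_setOf_mul_cos_sq_add_mul_sin_sq_eq_zero {p q : ℝ} (h : p ≠ 0 ∨ q ≠ 0) :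
    {θ : ℝ | θ ∈ Ioo 0 Real.pi ∧ p * Real.cos θ ^ 2 + q * Real.sin θ ^ 2 = 0}.encard =
      if p * q < 0 then 2 else if q = 0 then 1 else 0 := by
  split_ifs with hpq hq
  · exact encard_setOf_mul_cos_sq_add_mul_sin_sq_eq_zero_of_neg hpq
  · rw [encard_eq_one]
    refine ⟨Real.pi / 2, Set.ext fun θ => ?_⟩
    have hp := h.resolve_right (not_not.2 hq)
    simp only [mem_ofPred_eq, mem_singleton_iff, hq, zero_mul, add_zero, mul_eq_zero, hp,
      false_or, sq_eq_zero_iff]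
    refine ⟨fun hθ => (cos_eq_zero_iff_of_mem hθ.1).1 hθ.2, ?_⟩
    rintro rfl
    exact ⟨⟨by positivity, half_lt_self Real.pi_pos⟩, Real.cos_pi_div_two⟩
  · rw [encard_eq_zero, eq_empty_iff_forall_notMem]
    exact fun θ hθ =>
      mul_cos_sq_add_mul_sin_sq_ne_zero hq (not_lt.1 hpq) (sin_pos_of_mem hθ.1).ne' hθ.2

theorem encard_setOf_FKappaHat2_eq_zero {a w : ℝ} (hw : 0 < w) :
    {θ : ℝ | θ ∈ Ioo 0 Real.pi \ {Real.pi / 2} ∧ FKappaHat2 a w θ = 0}.encard =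
      if 2 * w + a < 0 then 2 else 0 := by
  rcases eq_or_ne (2 * w + a) 0 with h | h
  · rw [if_neg h.not_lt, encard_eq_zero, eq_empty_iff_forall_notMem]
    rintro θ ⟨⟨hθ, hne⟩, h0⟩
    have hc : Real.cos θ ≠ 0 := fun hc => hne ((cos_eq_zero_iff_of_mem hθ).1 hc)
    rw [FKappaHat2, h, zero_mul, add_zero] at h0
    exact mul_ne_zero hc (mul_ne_zero hw.ne' (pow_ne_zero 2 hc)) h0
  · have hset : {θ : ℝ | θ ∈ Ioo 0 Real.pi \ {Real.pi / 2} ∧ FKappaHat2 a w θ = 0} =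
        {θ : ℝ | θ ∈ Ioo 0 Real.pi ∧
          w * Real.cos θ ^ 2 + (2 * w + a) * Real.sin θ ^ 2 = 0} := by
      ext θ
      simp only [mem_ofPred_eq, Set.mem_sdiff, mem_singleton_iff, and_assoc]
      refine and_congr_right fun hθ => ?_
      rw [← cos_eq_zero_iff_of_mem hθ, FKappaHat2, mul_eq_zero]
      refine ⟨fun H => H.2.resolve_left H.1, fun H => ⟨fun hc => ?_, .inr H⟩⟩
      rw [hc, zero_pow two_ne_zero, mul_zero, zero_add] at H
      exact mul_ne_zero h (pow_ne_zero 2 (sin_pos_of_mem hθ).ne') H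
    rw [hset, encard_setOf_mul_cos_sq_add_mul_sin_sq_eq_zero (.inl hw.ne'), if_neg h]
    simp only [← neg_pos (a := w * _), ← mul_neg, mul_pos_iff_of_pos_left hw, neg_pos]

theorem encard_setOf_FDelta_eq_zero {a b w : ℝ} (hw : 0 < w) :
    {θ : ℝ | θ ∈ Ioo 0 Real.pi ∧ FDelta a b w θ = 0}.encard =
      if 0 < (2 * w + a) * (w + 2 * a) then 2 else if w + 2 * a = 0 then 1 else 0 := by
  have h : 2 * w + a ≠ 0 ∨ -(w + 2 * a) ≠ 0 := by
    by_contra! h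
    linarith [h.1, h.2]
  have hset (θ : ℝ) : FDelta a b w θ = 0 ↔
      (2 * w + a) * Real.cos θ ^ 2 + -(w + 2 * a) * Real.sin θ ^ 2 = 0 := by
    rw [FDelta_eq, mul_eq_zero_iff_left (limitNormalSq_pos b hw θ).ne', neg_mul, sub_eq_add_neg]
  simp only [hset, encard_setOf_mul_cos_sq_add_mul_sin_sq_eq_zero h, mul_neg, neg_lt_zero,
    neg_eq_zero]

end Counting

end WhitneyUmbrella

open WhitneyUmbrella in
theorem mainTheorem4_general {f : ℝ × ℝ → Fin 3 → ℝ} {k : ℕ} {b : ℕ → ℝ} {a : ℕ → ℕ → ℝ}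
    (h : IsNormalForm f k b a) :
    IsFirstTerm (kappaHat2 f) (FKappaHat2 (a 2 0) (a 0 2)) ∧
    IsFirstTerm (delta f) (FDelta (a 2 0) (a 1 1) (a 0 2)) ∧
    (∀ F, IsFirstTerm (kappaHat2 f) F →
      {θ : ℝ | θ ∈ Ioo 0 Real.pi \ {Real.pi / 2} ∧ F θ = 0}.encard =
        if 2 * a 0 2 + a 2 0 < 0 then 2 else 0) ∧
    ∀ F, IsFirstTerm (delta f) F →
      {θ : ℝ | θ ∈ Ioo 0 Real.pi ∧ F θ = 0}.encard =
        if 0 < (2 * a 0 2 + a 2 0) * (a 0 2 + 2 * a 2 0) then 2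
        else if a 0 2 + 2 * a 2 0 = 0 then 1 else 0 := by
  refine ⟨h.isFirstTerm_kappaHat2, h.isFirstTerm_delta, fun F hF => ?_, fun F hF => ?_⟩
  · rw [← encard_setOf_FKappaHat2_eq_zero h.a02_pos]
    exact congrArg encard <| Set.ext fun θ => and_congr_right fun hθ =>
      hF.eq_zero_iff h.isFirstTerm_kappaHat2 hθ.1
  · rw [← encard_setOf_FDelta_eq_zero (b := a 1 1) h.a02_pos]
    exact congrArg encard <| Set.ext fun θ => and_congr_right fun hθ =>
      hF.eq_zero_iff h.isFirstTerm_delta hθ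

theorem mainTheorem4 :
    -- `F_{κ̂₂}` and `F_δ` are first terms of `κ̂₂` and `δ`
    (∀ (f : ℝ × ℝ → Fin 3 → ℝ) (k : ℕ) (b : ℕ → ℝ) (a : ℕ → ℕ → ℝ),
      WhitneyUmbrella.IsNormalForm f k b a →
        WhitneyUmbrella.IsFirstTerm (WhitneyUmbrella.kappaHat2 f)
          (WhitneyUmbrella.FKappaHat2 (a 2 0) (a 0 2)) ∧
        WhitneyUmbrella.IsFirstTerm (WhitneyUmbrella.delta f)
          (WhitneyUmbrella.FDelta (a 2 0) (a 1 1) (a 0 2))) ∧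
    -- (1), for coefficients outside a proper algebraic subset of the `(a₂₀, a₁₁, a₀₂)`-space
    (∃ P : MvPolynomial (Fin 3) ℝ, P ≠ 0 ∧
      ∀ (f : ℝ × ℝ → Fin 3 → ℝ) (k : ℕ) (b : ℕ → ℝ) (a : ℕ → ℕ → ℝ),
        WhitneyUmbrella.IsNormalForm f k b a →
        MvPolynomial.eval ![a 2 0, a 1 1, a 0 2] P ≠ 0 →
        2 * a 2 0 + a 0 2 < 0 →
        ∀ F : ℝ → ℝ, WhitneyUmbrella.IsFirstTerm (WhitneyUmbrella.kappaHat2 f) F →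
          Set.encard {θ : ℝ | θ ∈ Set.Ioo 0 Real.pi \ {Real.pi / 2} ∧ F θ = 0} = 2 ∨
          Set.encard {θ : ℝ | θ ∈ Set.Ioo 0 Real.pi \ {Real.pi / 2} ∧ F θ = 0} = 0) ∧
    -- (2), first part, for coefficients outside a proper algebraic subset
    (∃ P : MvPolynomial (Fin 3) ℝ, P ≠ 0 ∧
      ∀ (f : ℝ × ℝ → Fin 3 → ℝ) (k : ℕ) (b : ℕ → ℝ) (a : ℕ → ℕ → ℝ),
        WhitneyUmbrella.IsNormalForm f k b a →
        MvPolynomial.eval ![a 2 0, a 1 1, a 0 2] P ≠ 0 →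
        2 * a 0 2 + a 2 0 ≠ 0 →
        ∀ F : ℝ → ℝ, WhitneyUmbrella.IsFirstTerm (WhitneyUmbrella.delta f) F →
          Set.encard {θ : ℝ | θ ∈ Set.Ioo 0 Real.pi ∧ F θ = 0} = 4 ∨
          Set.encard {θ : ℝ | θ ∈ Set.Ioo 0 Real.pi ∧ F θ = 0} = 2 ∨
          Set.encard {θ : ℝ | θ ∈ Set.Ioo 0 Real.pi ∧ F θ = 0} = 0) ∧
    -- (2), second part
    (∀ (f : ℝ × ℝ → Fin 3 → ℝ) (k : ℕ) (b : ℕ → ℝ) (a : ℕ → ℕ → ℝ),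
      WhitneyUmbrella.IsNormalForm f k b a →
      2 * a 0 2 + a 2 0 = 0 →
      ∀ F : ℝ → ℝ, WhitneyUmbrella.IsFirstTerm (WhitneyUmbrella.delta f) F →
        ∀ θ ∈ Set.Ioo 0 Real.pi, F θ ≠ 0) := by
  refine ⟨fun f k b a h => (mainTheorem4_general h).imp_right And.left,
    ⟨1, one_ne_zero, fun f k b a h _ _ F hF => ?_⟩,
    ⟨MvPolynomial.X 2 + 2 * MvPolynomial.X 0, fun h0 => ?_, fun f k b a h hP _ F hF => ?_⟩,
    fun f k b a h h0 F hF θ hθ hz => ?_⟩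
  · rw [(mainTheorem4_general h).2.2.1 F hF]
    exact ite_eq_or_eq _ _ _
  · simpa using congrArg (MvPolynomial.eval ![0, 0, 1]) h0
  · have hP : a 0 2 + 2 * a 2 0 ≠ 0 := by simpa using hP
    rw [(mainTheorem4_general h).2.2.2 F hF, if_neg hP]
    exact .inr (ite_eq_or_eq _ _ _)
  · have hempty := (mainTheorem4_general h).2.2.2 F hF
    rw [h0, zero_mul, if_neg (lt_irrefl 0), if_neg (by linarith [h.a02_pos]),
      Set.encard_eq_zero] at hempty
    exact hempty.subset ⟨hθ, hz⟩
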